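/- Let $k,l\ge 1$ be integers and let $R$ be a commutative ring with $1$. For $m\in\mathbb{Z}^k$ put $|m|=m_1+\dots+m_k$, and order $\mathbb{Z}^k$ componentwise. Let $\Lambda$ be the standard $k$-graph of level $l$: its vertex set is $\Lambda^0=\mathbb{Z}^k$, its paths (morphisms) are the triples $(v,w,p)$ with $v,w\in\mathbb{Z}^k$, $v\ge w$ and $p\in\{1,\dots,l\}^{|v-w|}$, with range $r(v,w,p)=v$, source $s(v,w,p)=w$, degree $d(v,w,p)=v-w\in\mathbb{N}^k$ and composition $(u,v,p)\circ(v,w,q)=(u,w,p\times q)$, where $p\times q$ is the concatenation; a vertex $v$ is identified with $(v,v,())$. Let $\Lambda^{\neq 0}$ be the set of paths of nonzero degree, let $v\Lambda^n$ be the set of paths of range $v$ and degree $n$, and let $\lambda\mapsto\lambda^*$ be a bijection from $\Lambda^{\ne 0}$ onto a set of symbols (ghost paths) disjoint from $\Lambda$. The Kumjian–Pask algebra $KP_R(\Lambda)$ is the associative, not necessarily unital, $R$-algebra presented by the generators $\Lambda^0\cup\Lambda^{\neq 0}\cup(\Lambda^{\neq 0})^*$ and the relations 1. $vw=\delta_{v,w}v$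 for $v,w\in\Lambda^0$; 2. $\lambda\mu=\lambda\circ\mu$ and $\mu^*\lambda^*=(\lambda\circ\mu)^*$ for $\lambda,\mu\in\Lambda^{\neq0}$ with $s(\lambda)=r(\mu)$, and $r(\lambda)\lambda=\lambda=\lambda s(\lambda)$, $s(\lambda)\lambda^*=\lambda^*=\lambda^*r(\lambda)$ for $\lambda\in\Lambda^{\neq 0}$; 3. $\lambda^*\mu=\delta_{\lambda,\mu}s(\lambda)$ for $\lambda,\mu\in\Lambda^{\neq 0}$ with $d(\lambda)=d(\mu)$; 4. $v=\sum_{\lambda\in v\Lambda^n}\lambda\lambda^*$ for $v\in\Lambda^0$ and $n\in\mathbb{N}^k\setminus\{0\}$. For $v\in\mathbb{Z}^k$ and $n\in\mathbb{N}^k\setminus\{0\}$ put $\lambda^{v,n}=(v,v-n,(1,\dots,1))$. Let $\mathcal{A}$ be the set of all pairs $(\lambda,\mu)$ with $\lambda,\mu\in\Lambda^{\neq 0}$ and $s(\lambda)=s(\mu)$ for which there are no $n\in\mathbb{N}^k\setminus\{0\}$ and $\lambda',\mu'\in\Lambda$ with $\lambda=\lambda'\circ\lambda^{s(\lambda'),n}$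 and $\mu=\mu'\circ\lambda^{s(\mu'),n}$. For $(\lambda,\mu),(\lambda',\mu')\in\mathcal{A}$ write $(\lambda,\mu)\sim(\lambda',\mu')$ if there are $m,n\in\mathbb{N}^k\setminus\{0\}$ with $\lambda\circ\lambda^{s(\lambda),m}=\lambda'\circ\lambda^{s(\lambda'),n}$ and $\mu\circ\lambda^{s(\mu),m}=\mu'\circ\lambda^{s(\mu'),n}$; this is an equivalence relation on $\mathcal{A}$. Let $\mathcal{R}\subseteq\mathcal{A}$ be any set that contains exactly one element of each equivalence class. Then the family consisting of the elements $v$ $(v\in\Lambda^0)$, $\lambda$ $(\lambda\in\Lambda^{\neq0})$, $\lambda^*$ $(\lambda\in\Lambda^{\neq0})$ and $\lambda\mu^*$ $((\lambda,\mu)\in\mathcal{R})$ is a basis of the $R$-module $KP_R(\Lambda)$. -/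

import Mathlib

universe u

/-- A `k`-graph: a countable small category, presented by its set `Vertex` of objects, its set `Path`
of morphisms, its codomain map `r` and domain map `s`, the identities and the composition
(`comp a b` is the morphism `a ∘ b`, defined when `s a = r b`), with a degree functor `d` to `ℕ^k`
that has the factorization property. -/
structure KGraph (k : ℕ) where
  Vertex : Type u
  Path : Type u
  countable_path : Countable Path
  r : Path → Vertex
  s : Path → Vertex
  ident : Vertex → Path
  comp : (a b : Path) → s a = r b → Path
  r_ident : ∀ v, r (ident v) = v
  s_ident : ∀ v, s (ident v) = v
  r_comp : ∀ a b h, r (comp a b h) = r a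
  s_comp : ∀ a b h, s (comp a b h) = s b
  ident_comp : ∀ a, comp (ident (r a)) a (s_ident (r a)) = a
  comp_ident : ∀ a, comp a (ident (s a)) (r_ident (s a)).symm = a
  comp_assoc : ∀ a b c (h₁ : s a = r b) (h₂ : s b = r c),
    comp (comp a b h₁) c ((s_comp a b h₁).trans h₂) =
      comp a (comp b c h₂) (h₁.trans (r_comp b c h₂).symm)
  d : Path → (Fin k → ℕ)
  d_ident : ∀ v, d (ident v) = 0
  d_comp : ∀ a b h, d (comp a b h) = d a + d b
  factorization : ∀ (a : Path) (m n : Fin k → ℕ), d a = m + n →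
    ∃! bc : Path × Path, d bc.1 = m ∧ d bc.2 = n ∧ ∃ h : s bc.1 = r bc.2, a = comp bc.1 bc.2 h

namespace KGraph

variable {k : ℕ} (Λ : KGraph.{u} k)

/-- Every `v Λ^n` is finite. -/
class RowFinite : Prop where
  finite : ∀ (v : Λ.Vertex) (n : Fin k → ℕ), {a : Λ.Path | Λ.r a = v ∧ Λ.d a = n}.Finite

/-- Every `v Λ^n` is nonempty. -/
class NoSources : Prop where
  nonempty : ∀ (v : Λ.Vertex) (n : Fin k → ℕ), {a : Λ.Path | Λ.r a = v ∧ Λ.d a = n}.Nonempty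

/-- The paths of nonzero degree. -/
abbrev NonzeroPath : Type u := {a : Λ.Path // Λ.d a ≠ 0}

variable {Λ} in
/-- The composition of two paths of nonzero degree. -/
def NonzeroPath.comp (a b : Λ.NonzeroPath) (h : Λ.s a.1 = Λ.r b.1) : Λ.NonzeroPath :=
  ⟨Λ.comp a.1 b.1 h, fun h0 => a.2 (by
    rw [Λ.d_comp] at h0
    exact (add_eq_zero.mp h0).1)⟩

/-- The set of generators: vertices, paths of nonzero degree and their ghost paths. -/
inductive Gen : Type u
  | vertex (v : Λ.Vertex)
  | path (a : Λ.NonzeroPath)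
  | ghost (a : Λ.NonzeroPath)

variable (R : Type*) [CommRing R]

/-- The free associative, not necessarily unital, `R`-algebra on the generators: the semigroup
algebra of the free semigroup (of nonempty words). -/
abbrev FreeAlg := MonoidAlgebra R (FreeSemigroup Λ.Gen)

variable {Λ} in
/-- A generator as an element of the free algebra. -/
noncomputable def FreeAlg.of (x : Λ.Gen) : Λ.FreeAlg R :=
  MonoidAlgebra.single (FreeSemigroup.of x) 1

variable {Λ} in
/-- The elements of `v Λ^n` of nonzero degree (all of `v Λ^n` if `n ≠ 0`). -/
noncomputable def pathsOfDegree [Λ.RowFinite] (v : Λ.Vertex) (n : Fin k → ℕ) :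
    Finset Λ.NonzeroPath :=
  ((RowFinite.finite v n).preimage (f := fun a : Λ.NonzeroPath => a.1)
    Subtype.val_injective.injOn).toFinset

open FreeAlg Gen in
/-- The relations (KP1)--(KP4), each written as `lhs ~ rhs`. -/
inductive KPRel [Λ.RowFinite] : Λ.FreeAlg R → Λ.FreeAlg R → Prop
  | vertex_idem (v : Λ.Vertex) : KPRel (of R (vertex v) * of R (vertex v)) (of R (vertex v))
  | vertex_orth (v w : Λ.Vertex) (h : v ≠ w) : KPRel (of R (vertex v) * of R (vertex w)) 0
  | path_mul (a b : Λ.NonzeroPath) (h : Λ.s a.1 = Λ.r b.1) :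
      KPRel (of R (path a) * of R (path b)) (of R (path (a.comp b h)))
  | ghost_mul (a b : Λ.NonzeroPath) (h : Λ.s a.1 = Λ.r b.1) :
      KPRel (of R (ghost b) * of R (ghost a)) (of R (ghost (a.comp b h)))
  | r_mul_path (a : Λ.NonzeroPath) :
      KPRel (of R (vertex (Λ.r a.1)) * of R (path a)) (of R (path a))
  | path_mul_s (a : Λ.NonzeroPath) :
      KPRel (of R (path a) * of R (vertex (Λ.s a.1))) (of R (path a))
  | s_mul_ghost (a : Λ.NonzeroPath) :
      KPRel (of R (vertex (Λ.s a.1)) * of R (ghost a)) (of R (ghost a))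
  | ghost_mul_r (a : Λ.NonzeroPath) :
      KPRel (of R (ghost a) * of R (vertex (Λ.r a.1))) (of R (ghost a))
  | ghost_mul_path_self (a : Λ.NonzeroPath) :
      KPRel (of R (ghost a) * of R (path a)) (of R (vertex (Λ.s a.1)))
  | ghost_mul_path_ne (a b : Λ.NonzeroPath) (hd : Λ.d a.1 = Λ.d b.1) (h : a ≠ b) :
      KPRel (of R (ghost a) * of R (path b)) 0
  | vertex_eq_sum (v : Λ.Vertex) (n : Fin k → ℕ) (hn : n ≠ 0) :
      KPRel (of R (vertex v)) (∑ a ∈ pathsOfDegree v n, of R (path a) * of R (ghost a))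

/-- The `R`-algebra congruence generated by (KP1)--(KP4). As the free algebra has no unit, closure
under scalar multiplication has to be asked for separately, which is done by passing to all scalar
multiples of the relations. -/
noncomputable def kpCon [Λ.RowFinite] : RingCon (Λ.FreeAlg R) :=
  ringConGen fun x y => ∃ (c : R) (x₀ y₀ : Λ.FreeAlg R),
    Λ.KPRel R x₀ y₀ ∧ x = c • x₀ ∧ y = c • y₀

theorem kpCon_smul [Λ.RowFinite] (c : R) {x y : Λ.FreeAlg R} (h : Λ.kpCon R x y) :
    Λ.kpCon R (c • x) (c • y) := by
  change RingConGen.Rel _ _ _ at h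
  change RingConGen.Rel _ _ _
  induction h with
  | of x y h =>
    obtain ⟨e, x₀, y₀, h, rfl, rfl⟩ := h
    exact .of _ _ ⟨c * e, x₀, y₀, h, by rw [mul_smul], by rw [mul_smul]⟩
  | refl x => exact .refl _
  | symm _ ih => exact .symm ih
  | trans _ _ ih₁ ih₂ => exact .trans ih₁ ih₂
  | add _ _ ih₁ ih₂ =>
    rw [smul_add, smul_add]
    exact .add ih₁ ih₂
  | mul _ h₂ ih₁ _ =>
    rw [← smul_mul_assoc, ← smul_mul_assoc]
    exact .mul ih₁ h₂

/-- The Kumjian--Pask algebra of a row-finite `k`-graph. -/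
noncomputable def KP [Λ.RowFinite] := (Λ.kpCon R).Quotient

namespace KP

variable [Λ.RowFinite]

noncomputable instance : NonUnitalRing (Λ.KP R) :=
  inferInstanceAs (NonUnitalRing (Λ.kpCon R).Quotient)

/-- The class of an element of the free algebra. -/
noncomputable def mk (x : Λ.FreeAlg R) : Λ.KP R := RingCon.toQuotient (c := Λ.kpCon R) x

theorem mk_surjective : Function.Surjective (mk Λ R) := Quotient.mk''_surjective

/-- `mk` as an additive map. -/
noncomputable def mkHom : Λ.FreeAlg R →+ Λ.KP R where
  toFun := mk Λ R
  map_zero' := rfl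
  map_add' _ _ := rfl

noncomputable instance : SMul R (Λ.KP R) :=
  ⟨fun c => Quotient.map' (c • ·) fun _ _ h => kpCon_smul Λ R c h⟩

noncomputable instance : Module R (Λ.KP R) :=
  Function.Surjective.module R (mkHom Λ R) (mk_surjective Λ R) fun _ _ => rfl

instance : IsScalarTower R (Λ.KP R) (Λ.KP R) where
  smul_assoc c x y := by
    obtain ⟨x, rfl⟩ := mk_surjective Λ R x
    obtain ⟨y, rfl⟩ := mk_surjective Λ R y
    exact congrArg (mk Λ R) (smul_mul_assoc c x y)

instance : SMulCommClass R (Λ.KP R) (Λ.KP R) where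
  smul_comm c x y := by
    obtain ⟨x, rfl⟩ := mk_surjective Λ R x
    obtain ⟨y, rfl⟩ := mk_surjective Λ R y
    exact congrArg (mk Λ R) (mul_smul_comm c x y).symm

variable {Λ}

/-- The vertex `v` in the Kumjian--Pask algebra. -/
noncomputable def vertex (v : Λ.Vertex) : Λ.KP R := mk Λ R (FreeAlg.of R (.vertex v))

/-- The path `a` in the Kumjian--Pask algebra. -/
noncomputable def path (a : Λ.NonzeroPath) : Λ.KP R := mk Λ R (FreeAlg.of R (.path a))

/-- The ghost path `a*` in the Kumjian--Pask algebra. -/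
noncomputable def ghost (a : Λ.NonzeroPath) : Λ.KP R := mk Λ R (FreeAlg.of R (.ghost a))

end KP

end KGraph

/-- The paths `(v, w, p)` of the standard `k`-graph of level `l`: `v ≥ w` in `ℤ^k`, and `p` is a tuple
of `|v - w|` levels. The levels `1, …, l` are represented by the elements `0, …, l - 1` of `Fin l`. -/
@[ext]
structure StdPath (k l : ℕ) where
  rng : Fin k → ℤ
  src : Fin k → ℤ
  lv : List (Fin l)
  le : src ≤ rng
  length_lv : (lv.length : ℤ) = ∑ i, (rng i - src i)

namespace StdPath

variable {k l : ℕ}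

/-- `(u, v, p) ∘ (v, w, q) = (u, w, p × q)`. -/
def comp (a b : StdPath k l) (h : a.src = b.rng) : StdPath k l where
  rng := a.rng
  src := b.src
  lv := a.lv ++ b.lv
  le := b.le.trans (h ▸ a.le)
  length_lv := by
    rw [List.length_append, Nat.cast_add, a.length_lv, b.length_lv, h, ← Finset.sum_add_distrib]
    exact Finset.sum_congr rfl fun i _ => by ring

/-- `d(v, w, p) = v - w`. -/
def deg (a : StdPath k l) : Fin k → ℕ := fun i => (a.rng i - a.src i).toNat

theorem deg_cast (a : StdPath k l) (i : Fin k) : (a.deg i : ℤ) = a.rng i - a.src i :=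
  Int.toNat_of_nonneg (sub_nonneg.mpr (a.le i))

theorem length_eq (a : StdPath k l) : a.lv.length = ∑ i, a.deg i := by
  have h := a.length_lv
  simp only [← deg_cast] at h
  exact_mod_cast h

theorem src_eq (a : StdPath k l) : a.src = fun i => a.rng i - a.deg i := by
  funext i
  rw [deg_cast]
  ring

theorem ext_deg {a b : StdPath k l} (hr : a.rng = b.rng) (hd : a.deg = b.deg)
    (hl : a.lv = b.lv) : a = b :=
  StdPath.ext hr (by rw [src_eq a, src_eq b, hr, hd]) hl

/-- The path `(v, v - n, p)`. -/
def ofDeg (v : Fin k → ℤ) (n : Fin k → ℕ) (p : List (Fin l)) (hp : p.length = ∑ i, n i) :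
    StdPath k l where
  rng := v
  src := fun i => v i - n i
  lv := p
  le := fun i => by simp
  length_lv := by simp [hp]

theorem deg_ofDeg (v : Fin k → ℤ) (n : Fin k → ℕ) (p : List (Fin l)) (hp : p.length = ∑ i, n i) :
    (ofDeg v n p hp).deg = n := by
  funext i
  simp [deg, ofDeg]

theorem deg_comp (a b : StdPath k l) (h : a.src = b.rng) :
    (a.comp b h).deg = a.deg + b.deg := by
  funext i
  have h1 := deg_cast (a.comp b h) i
  have h2 := deg_cast a i
  have h3 := deg_cast b i
  have h4 := congrFun h i
  simp only [comp] at h1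
  simp only [Pi.add_apply]
  simp only [comp]
  omega

instance : Countable (StdPath k l) :=
  Function.Injective.countable (f := fun a : StdPath k l => (a.rng, a.src, a.lv)) fun a b h => by
    simp only [Prod.mk.injEq] at h
    exact StdPath.ext h.1 h.2.1 h.2.2

theorem factorization (a : StdPath k l) (m n : Fin k → ℕ) (h : a.deg = m + n) :
    ∃! bc : StdPath k l × StdPath k l, bc.1.deg = m ∧ bc.2.deg = n ∧
      ∃ h : bc.1.src = bc.2.rng, a = bc.1.comp bc.2 h := by
  have hlen : a.lv.length = ∑ i, m i + ∑ i, n i := by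
    rw [length_eq, h, ← Finset.sum_add_distrib]
    rfl
  have h1 : (a.lv.take (∑ i, m i)).length = ∑ i, m i := by simp [hlen]
  have h2 : (a.lv.drop (∑ i, m i)).length = ∑ i, n i := by simp [hlen]
  refine ⟨(ofDeg a.rng m (a.lv.take (∑ i, m i)) h1,
    ofDeg (fun i => a.rng i - m i) n (a.lv.drop (∑ i, m i)) h2),
    ⟨deg_ofDeg _ _ _ h1, deg_ofDeg _ _ _ h2, rfl, ?_⟩, ?_⟩
  · refine ext_deg rfl ?_ ?_
    · refine Eq.trans ?_ (deg_comp (ofDeg _ _ _ h1) (ofDeg _ _ _ h2) rfl).symm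
      rw [deg_ofDeg, deg_ofDeg, h]
    · simp [comp, ofDeg]
  · rintro ⟨b, c⟩ ⟨hb, hc, hbc, rfl⟩
    simp only at hb hc hbc
    have hlb : b.lv.length = ∑ i, m i := by rw [length_eq, hb]
    refine Prod.ext (ext_deg rfl ?_ ?_) (ext_deg ?_ ?_ ?_)
    · rw [deg_ofDeg, hb]
    · simp [comp, ofDeg, ← hlb]
    · simp only [ofDeg, comp]
      rw [← hbc, src_eq b, hb]
    · rw [deg_ofDeg, hc]
    · simp [comp, ofDeg, ← hlb]

end StdPath

/-- The standard `k`-graph of level `l`. -/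
abbrev stdKGraph (k l : ℕ) : KGraph.{0} k where
  Vertex := Fin k → ℤ
  Path := StdPath k l
  countable_path := inferInstance
  r := StdPath.rng
  s := StdPath.src
  ident v := ⟨v, v, [], le_rfl, by simp⟩
  comp := StdPath.comp
  r_ident _ := rfl
  s_ident _ := rfl
  r_comp _ _ _ := rfl
  s_comp _ _ _ := rfl
  ident_comp _ := StdPath.ext rfl rfl rfl
  comp_ident _ := StdPath.ext rfl rfl (List.append_nil _)
  comp_assoc _ _ _ _ _ := StdPath.ext rfl rfl (List.append_assoc _ _ _)
  d := StdPath.deg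
  d_ident _ := by funext i; simp [StdPath.deg]
  d_comp := StdPath.deg_comp
  factorization := StdPath.factorization

instance (k l : ℕ) : (stdKGraph k l).RowFinite where
  finite v n := by
    refine Set.Finite.of_finite_image (f := StdPath.lv)
      ((List.finite_length_eq (Fin l) (∑ i, n i)).subset ?_) ?_
    · rintro _ ⟨a, ⟨_, hd⟩, rfl⟩
      exact (StdPath.length_eq a).trans (congrArg (fun d : Fin k → ℕ => ∑ i, d i) hd)
    · rintro a ⟨ha, hda⟩ b ⟨hb, hdb⟩ hab
      exact StdPath.ext_deg (ha.trans hb.symm) (hda.trans hdb.symm) hab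

namespace StdPath

variable {k l : ℕ} [NeZero l]

/-- The path `λ^{v,n} = (v, v - n, (1, …, 1))`; the level `1` is the element `0` of `Fin l`. -/
def allOnes (v : Fin k → ℤ) (n : Fin k → ℕ) : StdPath k l :=
  ofDeg v n (List.replicate (∑ i, n i) 0) (by simp)

/-- The path `a ∘ λ^{s(a),n}`. -/
def extendOnes (a : StdPath k l) (n : Fin k → ℕ) : StdPath k l :=
  a.comp (allOnes a.src n) rfl

end StdPath

instance (k l : ℕ) [NeZero l] : (stdKGraph k l).NoSources where
  nonempty v n := ⟨StdPath.allOnes v n, rfl, StdPath.deg_ofDeg ..⟩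

/-- The paths of nonzero degree in the standard `k`-graph of level `l`. -/
abbrev StdNonzeroPath (k l : ℕ) : Type := (stdKGraph k l).NonzeroPath

/-- The set `Â` of pairs of paths of nonzero degree with common source. -/
def pairsHat (k l : ℕ) : Set (StdNonzeroPath k l × StdNonzeroPath k l) :=
  {x | (stdKGraph k l).s x.1.1 = (stdKGraph k l).s x.2.1}

/-- The set `A` of the pairs in `Â` that have no common tail `λ^{∼,n}` with `n ≠ 0`. -/
def pairsA (k l : ℕ) [NeZero l] : Set (StdNonzeroPath k l × StdNonzeroPath k l) :=
  {x | x ∈ pairsHat k l ∧ ¬ ∃ (n : Fin k → ℕ) (a b : StdPath k l),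
    n ≠ 0 ∧ x.1.1 = a.extendOnes n ∧ x.2.1 = b.extendOnes n}

/-- The equivalence relation `∼` (used on the pairs in `A` only). -/
def PairEquiv {k l : ℕ} [NeZero l] (x y : StdNonzeroPath k l × StdNonzeroPath k l) : Prop :=
  ∃ m n : Fin k → ℕ, m ≠ 0 ∧ n ≠ 0 ∧
    StdPath.extendOnes x.1.1 m = StdPath.extendOnes y.1.1 n ∧
    StdPath.extendOnes x.2.1 m = StdPath.extendOnes y.2.1 n

/-- `𝓡` consists of exactly one representative of each equivalence class of `∼` on `A`. -/
def IsRepresentativeSet {k l : ℕ} [NeZero l]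
    (𝓡 : Set (StdNonzeroPath k l × StdNonzeroPath k l)) : Prop :=
  𝓡 ⊆ pairsA k l ∧ ∀ x ∈ pairsA k l, ∃! y, y ∈ 𝓡 ∧ PairEquiv x y

/-!
A product `a b*` depends only on the ranges and the words of `a` and `b`: sources of equal weight
have a common lower vertex, and (KP4) expands both products into the same sum there. Read backwards
in a unit degree, (KP4) strips a common final `1` from `a` and `b` at the cost of products without
one, so the products of reduced pairs span. Two reduced pairs that agree after appending infinitely
many `1`s have the same ranges and words, since otherwise the longer pair could be shortened in some
coordinate. Hence each basis element is determined by a pair of infinite paths, and in the action on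
functions of infinite paths the products `a b*` are triangular with respect to the length of `a`.
-/

namespace KGraph

variable {k : ℕ} {Λ : KGraph.{u} k}

theorem ident_injective : Function.Injective Λ.ident := Function.LeftInverse.injective Λ.r_ident

theorem eq_ident_of_d_eq_zero {a : Λ.Path} (h : Λ.d a = 0) : a = Λ.ident (Λ.r a) := by
  obtain ⟨x, -, hx⟩ := Λ.factorization a 0 0 (by simp [h])
  have h1 := hx (Λ.ident (Λ.r a), a) ⟨Λ.d_ident _, h, Λ.s_ident _, (Λ.ident_comp a).symm⟩
  have h2 := hx (a, Λ.ident (Λ.s a)) ⟨h, Λ.d_ident _, (Λ.r_ident _).symm, (Λ.comp_ident a).symm⟩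
  exact congrArg Prod.fst (h2.trans h1.symm)

theorem ident_induction {P : Λ.Path → Prop} (ident : ∀ v, P (Λ.ident v))
    (nonzero : ∀ a : Λ.NonzeroPath, P a.1) (a : Λ.Path) : P a := by
  by_cases h : Λ.d a = 0
  · exact eq_ident_of_d_eq_zero h ▸ ident (Λ.r a)
  · exact nonzero ⟨a, h⟩

theorem mem_pathsOfDegree [Λ.RowFinite] {v : Λ.Vertex} {n : Fin k → ℕ} {a : Λ.NonzeroPath} :
    a ∈ pathsOfDegree v n ↔ Λ.r a.1 = v ∧ Λ.d a.1 = n := by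
  simp [pathsOfDegree]

variable (Λ) in
/-- A Kumjian–Pask `Λ`-family in `S`: a solution of the relations (KP1)–(KP4). The paths of degree
zero are included, as the vertices, so that (KP1) and the absorption laws in (KP2) become instances
of the multiplicativity of `path` and `ghost` and of (KP3). -/
structure KPFamily [Λ.RowFinite] (S : Type*) [NonUnitalSemiring S] where
  path : Λ.Path → S
  ghost : Λ.Path → S
  ghost_ident : ∀ v, ghost (Λ.ident v) = path (Λ.ident v)
  path_mul_path : ∀ {a b} (h : Λ.s a = Λ.r b), path a * path b = path (Λ.comp a b h)
  ghost_mul_ghost : ∀ {a b} (h : Λ.s a = Λ.r b), ghost b * ghost a = ghost (Λ.comp a b h)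
  ghost_mul_path_self : ∀ a, ghost a * path a = path (Λ.ident (Λ.s a))
  ghost_mul_path_of_ne : ∀ {a b}, Λ.d a = Λ.d b → a ≠ b → ghost a * path b = 0
  path_ident_eq_sum : ∀ v {n : Fin k → ℕ}, n ≠ 0 →
    path (Λ.ident v) = ∑ c ∈ pathsOfDegree v n, path c.1 * ghost c.1

namespace KPFamily

variable [Λ.RowFinite] {S : Type*}

section NonUnitalSemiring

variable [NonUnitalSemiring S] (F : Λ.KPFamily S)

theorem path_ident_mul_path (a : Λ.Path) : F.path (Λ.ident (Λ.r a)) * F.path a = F.path a := by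
  rw [F.path_mul_path (Λ.s_ident _), Λ.ident_comp]

theorem path_mul_path_ident (a : Λ.Path) : F.path a * F.path (Λ.ident (Λ.s a)) = F.path a := by
  rw [F.path_mul_path (Λ.r_ident _).symm, Λ.comp_ident]

theorem path_ident_mul_ghost (a : Λ.Path) :
    F.path (Λ.ident (Λ.s a)) * F.ghost a = F.ghost a := by
  rw [← F.ghost_ident, F.ghost_mul_ghost (Λ.r_ident _).symm, Λ.comp_ident]

theorem ghost_mul_path_ident (a : Λ.Path) :
    F.ghost a * F.path (Λ.ident (Λ.r a)) = F.ghost a := by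
  rw [← F.ghost_ident, F.ghost_mul_ghost (Λ.s_ident _), Λ.ident_comp]

theorem path_ident_mul_self (v : Λ.Vertex) :
    F.path (Λ.ident v) * F.path (Λ.ident v) = F.path (Λ.ident v) := by
  simpa only [Λ.r_ident] using F.path_ident_mul_path (Λ.ident v)

theorem path_ident_mul_path_ident_of_ne {v w : Λ.Vertex} (h : v ≠ w) :
    F.path (Λ.ident v) * F.path (Λ.ident w) = 0 := by
  rw [← F.ghost_ident v]
  exact F.ghost_mul_path_of_ne (by rw [Λ.d_ident, Λ.d_ident]) (ident_injective.ne h)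

theorem path_mul_path_of_ne {a b : Λ.Path} (h : Λ.s a ≠ Λ.r b) : F.path a * F.path b = 0 := by
  rw [← F.path_mul_path_ident a, mul_assoc, ← F.path_ident_mul_path b,
    ← mul_assoc (F.path (Λ.ident _)), F.path_ident_mul_path_ident_of_ne h, zero_mul, mul_zero]

theorem path_mul_ghost_eq_sum {a b : Λ.Path} (h : Λ.s a = Λ.s b) {n : Fin k → ℕ} (hn : n ≠ 0) :
    F.path a * F.ghost b =
      ∑ c ∈ pathsOfDegree (Λ.s a) n, F.path a * F.path c.1 * (F.ghost c.1 * F.ghost b) := by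
  conv_lhs =>
    rw [← F.path_ident_mul_ghost b, ← h, F.path_ident_eq_sum (Λ.s a) hn, Finset.sum_mul,
      Finset.mul_sum]
  simp only [mul_assoc]

/-- The value of a Kumjian–Pask family on the generators of the Kumjian–Pask algebra. -/
def gen : Λ.Gen → S
  | .vertex v => F.path (Λ.ident v)
  | .path a => F.path a.1
  | .ghost a => F.ghost a.1

end NonUnitalSemiring

section MonomialSpan

variable (R : Type*) [CommSemiring R] [NonUnitalSemiring S] [Module R S] (F : Λ.KPFamily S)

/-- The span of the monomials `a b*`. -/
def monomialSpan : Submodule R S :=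
  Submodule.span R {x | ∃ a b, Λ.s a = Λ.s b ∧ F.path a * F.ghost b = x}

theorem path_mul_ghost_mem_monomialSpan {a b : Λ.Path} (h : Λ.s a = Λ.s b) :
    F.path a * F.ghost b ∈ F.monomialSpan R :=
  Submodule.subset_span ⟨a, b, h, rfl⟩

theorem ghost_mul_path_mul_ghost_mem_monomialSpan {a b c : Λ.Path} (h : Λ.s a = Λ.s b)
    (hle : Λ.d c ≤ Λ.d a) : F.ghost c * (F.path a * F.ghost b) ∈ F.monomialSpan R := by
  obtain ⟨⟨a₁, a₂⟩, ⟨h₁, -, hs, rfl⟩, -⟩ :=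
    Λ.factorization a (Λ.d c) (Λ.d a - Λ.d c) (add_tsub_cancel_of_le hle).symm
  simp only at h₁ hs h
  rw [← F.path_mul_path hs, ← mul_assoc, ← mul_assoc]
  by_cases hc : c = a₁
  · rw [hc, F.ghost_mul_path_self, hs, F.path_ident_mul_path]
    exact F.path_mul_ghost_mem_monomialSpan R ((Λ.s_comp _ _ _).symm.trans h)
  · rw [F.ghost_mul_path_of_ne h₁.symm hc, zero_mul, zero_mul]
    exact zero_mem _

theorem gen_mem_monomialSpan (g : Λ.Gen) : F.gen g ∈ F.monomialSpan R := by
  cases g with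
  | vertex v =>
    have h := F.path_mul_ghost_mem_monomialSpan R (a := Λ.ident v) rfl
    rwa [F.ghost_ident, F.path_ident_mul_self] at h
  | path a =>
    have h := F.path_mul_ghost_mem_monomialSpan R (a := a.1) (Λ.s_ident _).symm
    rwa [F.ghost_ident, F.path_mul_path_ident] at h
  | ghost a =>
    have h := F.path_mul_ghost_mem_monomialSpan R (b := a.1) (Λ.s_ident _)
    rwa [F.path_ident_mul_ghost] at h

variable [SMulCommClass R S S]

variable {R} in
theorem mul_mem_monomialSpan {x y : S}
    (hx : ∀ a b, Λ.s a = Λ.s b → x * (F.path a * F.ghost b) ∈ F.monomialSpan R)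
    (hy : y ∈ F.monomialSpan R) : x * y ∈ F.monomialSpan R := by
  have hmap : (F.monomialSpan R).map (LinearMap.mulLeft R x) ≤ F.monomialSpan R := by
    refine (Submodule.map_span_le _ _ _).mpr ?_
    rintro _ ⟨a, b, h, rfl⟩
    exact hx a b h
  exact hmap (Submodule.mem_map_of_mem hy)

theorem path_mul_mem_monomialSpan (c : Λ.Path) {y : S} (hy : y ∈ F.monomialSpan R) :
    F.path c * y ∈ F.monomialSpan R := by
  refine F.mul_mem_monomialSpan (fun a b h => ?_) hy
  rw [← mul_assoc]
  by_cases hc : Λ.s c = Λ.r a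
  · rw [F.path_mul_path hc]
    exact F.path_mul_ghost_mem_monomialSpan R ((Λ.s_comp _ _ _).trans h)
  · rw [F.path_mul_path_of_ne hc, zero_mul]
    exact zero_mem _

-- The expansion of `a b*` in degree `d c` makes the path part long enough to absorb `c*`.
theorem ghost_mul_mem_monomialSpan (c : Λ.NonzeroPath) {y : S} (hy : y ∈ F.monomialSpan R) :
    F.ghost c.1 * y ∈ F.monomialSpan R := by
  refine F.mul_mem_monomialSpan (fun a b h => ?_) hy
  rw [F.path_mul_ghost_eq_sum h c.2, Finset.mul_sum]
  refine sum_mem fun e he => ?_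
  obtain ⟨hr, hd⟩ := mem_pathsOfDegree.mp he
  rw [F.path_mul_path hr.symm, F.ghost_mul_ghost (h.symm.trans hr.symm)]
  refine F.ghost_mul_path_mul_ghost_mem_monomialSpan R (by rw [Λ.s_comp, Λ.s_comp]) ?_
  rw [Λ.d_comp, hd]
  exact le_add_self

theorem gen_mul_mem_monomialSpan (g : Λ.Gen) {y : S} (hy : y ∈ F.monomialSpan R) :
    F.gen g * y ∈ F.monomialSpan R :=
  match g with
  | .vertex v => F.path_mul_mem_monomialSpan R (Λ.ident v) hy
  | .path a => F.path_mul_mem_monomialSpan R a.1 hy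
  | .ghost a => F.ghost_mul_mem_monomialSpan R a hy

end MonomialSpan

section Lift

variable (R : Type*) [CommRing R] [NonUnitalRing S] [Module R S] [IsScalarTower R S S]
  [SMulCommClass R S S] (F : Λ.KPFamily S)

/-- The homomorphism from the free algebra that a Kumjian–Pask family extends to. -/
noncomputable def freeLift : Λ.FreeAlg R →ₙₐ[R] S :=
  MonoidAlgebra.liftMagma R (FreeSemigroup.lift F.gen)

@[simp]
theorem freeLift_of (g : Λ.Gen) : F.freeLift R (FreeAlg.of R g) = F.gen g := by
  simp [freeLift, FreeAlg.of]

theorem freeLift_eq_of_kpRel {x y : Λ.FreeAlg R} (h : Λ.KPRel R x y) :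
    F.freeLift R x = F.freeLift R y := by
  induction h with
  | vertex_idem v => simpa [gen] using F.path_ident_mul_self v
  | vertex_orth v w h => simpa [gen] using F.path_ident_mul_path_ident_of_ne h
  | path_mul a b h => simpa [gen, NonzeroPath.comp] using F.path_mul_path h
  | ghost_mul a b h => simpa [gen, NonzeroPath.comp] using F.ghost_mul_ghost h
  | r_mul_path a => simpa [gen] using F.path_ident_mul_path a.1
  | path_mul_s a => simpa [gen] using F.path_mul_path_ident a.1
  | s_mul_ghost a => simpa [gen] using F.path_ident_mul_ghost a.1
  | ghost_mul_r a => simpa [gen] using F.ghost_mul_path_ident a.1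
  | ghost_mul_path_self a => simpa [gen] using F.ghost_mul_path_self a.1
  | ghost_mul_path_ne a b hd h =>
    simpa [gen] using F.ghost_mul_path_of_ne hd (Subtype.coe_injective.ne h)
  | vertex_eq_sum v n hn => simpa [gen] using F.path_ident_eq_sum v hn

theorem freeLift_eq_of_kpCon {x y : Λ.FreeAlg R} (h : Λ.kpCon R x y) :
    F.freeLift R x = F.freeLift R y := by
  change RingConGen.Rel _ _ _ at h
  induction h with
  | of x y h =>
    obtain ⟨c, x₀, y₀, h, rfl, rfl⟩ := h
    rw [map_smul, map_smul, F.freeLift_eq_of_kpRel R h]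
  | refl x => rfl
  | symm _ ih => exact ih.symm
  | trans _ _ ih₁ ih₂ => exact ih₁.trans ih₂
  | add _ _ ih₁ ih₂ => rw [map_add, map_add, ih₁, ih₂]
  | mul _ _ ih₁ ih₂ => rw [map_mul, map_mul, ih₁, ih₂]

/-- The homomorphism from the Kumjian–Pask algebra that a Kumjian–Pask family extends to. -/
noncomputable def lift : Λ.KP R →ₙₐ[R] S where
  toFun := Quotient.lift (F.freeLift R) fun _ _ => F.freeLift_eq_of_kpCon R
  map_smul' c := by
    rintro ⟨x⟩
    exact map_smul (F.freeLift R) c x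
  map_zero' := map_zero (F.freeLift R)
  map_add' := by
    rintro ⟨x⟩ ⟨y⟩
    exact map_add (F.freeLift R) x y
  map_mul' := by
    rintro ⟨x⟩ ⟨y⟩
    exact map_mul (F.freeLift R) x y

theorem lift_mk_of (g : Λ.Gen) : F.lift R (KP.mk Λ R (FreeAlg.of R g)) = F.gen g :=
  F.freeLift_of R g

theorem freeLift_mem_monomialSpan (x : Λ.FreeAlg R) : F.freeLift R x ∈ F.monomialSpan R := by
  have word_mem (w : FreeSemigroup Λ.Gen) :
      FreeSemigroup.lift F.gen w ∈ F.monomialSpan R := by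
    induction w using FreeSemigroup.recOnMul with
    | ih1 g => exact F.gen_mem_monomialSpan R g
    | ih2 g w _ ih =>
      rw [map_mul, FreeSemigroup.lift_of]
      exact F.gen_mul_mem_monomialSpan R g ih
  rw [freeLift, MonoidAlgebra.liftMagma_apply_apply]
  exact sum_mem fun w _ => Submodule.smul_mem _ _ (word_mem w)

end Lift

end KPFamily

namespace KP

variable [Λ.RowFinite] (R : Type*) [CommRing R]

theorem mk_eq_mk {x y : Λ.FreeAlg R} (h : Λ.KPRel R x y) : mk Λ R x = mk Λ R y :=
  Quotient.sound (RingConGen.Rel.of _ _ ⟨1, x, y, h, by rw [one_smul], by rw [one_smul]⟩)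

open Classical in
/-- The path `a` of any degree in the Kumjian–Pask algebra. -/
noncomputable def pathOf (a : Λ.Path) : Λ.KP R :=
  if h : Λ.d a = 0 then vertex R (Λ.r a) else path R ⟨a, h⟩

open Classical in
/-- The ghost path `a*` of a path of any degree in the Kumjian–Pask algebra. -/
noncomputable def ghostOf (a : Λ.Path) : Λ.KP R :=
  if h : Λ.d a = 0 then vertex R (Λ.r a) else ghost R ⟨a, h⟩

@[simp]
theorem pathOf_ident (v : Λ.Vertex) : pathOf R (Λ.ident v) = vertex R v := by
  rw [pathOf, dif_pos (Λ.d_ident v), Λ.r_ident]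

@[simp]
theorem ghostOf_ident (v : Λ.Vertex) : ghostOf R (Λ.ident v) = vertex R v := by
  rw [ghostOf, dif_pos (Λ.d_ident v), Λ.r_ident]

@[simp]
theorem pathOf_coe (a : Λ.NonzeroPath) : pathOf R a.1 = path R a := dif_neg a.2

@[simp]
theorem ghostOf_coe (a : Λ.NonzeroPath) : ghostOf R a.1 = ghost R a := dif_neg a.2

theorem vertex_mul_self (v : Λ.Vertex) : vertex R v * vertex R v = vertex R v :=
  mk_eq_mk R (.vertex_idem v)

theorem vertex_mul_of_ne {v w : Λ.Vertex} (h : v ≠ w) : vertex R v * vertex R w = 0 :=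
  mk_eq_mk R (.vertex_orth v w h)

theorem vertex_mul_pathOf (a : Λ.Path) : vertex R (Λ.r a) * pathOf R a = pathOf R a := by
  induction a using ident_induction with
  | ident v => rw [Λ.r_ident, pathOf_ident, vertex_mul_self]
  | nonzero a =>
    rw [pathOf_coe]
    exact mk_eq_mk R (.r_mul_path a)

theorem pathOf_mul_vertex (a : Λ.Path) : pathOf R a * vertex R (Λ.s a) = pathOf R a := by
  induction a using ident_induction with
  | ident v => rw [Λ.s_ident, pathOf_ident, vertex_mul_self]
  | nonzero a =>
    rw [pathOf_coe]
    exact mk_eq_mk R (.path_mul_s a)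

theorem vertex_mul_ghostOf (a : Λ.Path) : vertex R (Λ.s a) * ghostOf R a = ghostOf R a := by
  induction a using ident_induction with
  | ident v => rw [Λ.s_ident, ghostOf_ident, vertex_mul_self]
  | nonzero a =>
    rw [ghostOf_coe]
    exact mk_eq_mk R (.s_mul_ghost a)

theorem ghostOf_mul_vertex (a : Λ.Path) : ghostOf R a * vertex R (Λ.r a) = ghostOf R a := by
  induction a using ident_induction with
  | ident v => rw [Λ.r_ident, ghostOf_ident, vertex_mul_self]
  | nonzero a =>
    rw [ghostOf_coe]
    exact mk_eq_mk R (.ghost_mul_r a)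

theorem pathOf_mul_pathOf {a b : Λ.Path} (h : Λ.s a = Λ.r b) :
    pathOf R a * pathOf R b = pathOf R (Λ.comp a b h) := by
  induction a using ident_induction with
  | ident v =>
    obtain rfl : v = Λ.r b := (Λ.s_ident v).symm.trans h
    rw [pathOf_ident, vertex_mul_pathOf, Λ.ident_comp]
  | nonzero a =>
    induction b using ident_induction with
    | ident v =>
      obtain rfl : Λ.s a.1 = v := h.trans (Λ.r_ident v)
      rw [pathOf_ident, pathOf_mul_vertex, Λ.comp_ident]
    | nonzero b =>
      rw [pathOf_coe, pathOf_coe]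
      exact (mk_eq_mk R (.path_mul a b h)).trans (pathOf_coe R (a.comp b h)).symm

theorem ghostOf_mul_ghostOf {a b : Λ.Path} (h : Λ.s a = Λ.r b) :
    ghostOf R b * ghostOf R a = ghostOf R (Λ.comp a b h) := by
  induction a using ident_induction with
  | ident v =>
    obtain rfl : v = Λ.r b := (Λ.s_ident v).symm.trans h
    rw [ghostOf_ident, ghostOf_mul_vertex, Λ.ident_comp]
  | nonzero a =>
    induction b using ident_induction with
    | ident v =>
      obtain rfl : Λ.s a.1 = v := h.trans (Λ.r_ident v)
      rw [ghostOf_ident, vertex_mul_ghostOf, Λ.comp_ident]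
    | nonzero b =>
      rw [ghostOf_coe, ghostOf_coe]
      exact (mk_eq_mk R (.ghost_mul a b h)).trans (ghostOf_coe R (a.comp b h)).symm

theorem ghostOf_mul_pathOf_self (a : Λ.Path) : ghostOf R a * pathOf R a = vertex R (Λ.s a) := by
  induction a using ident_induction with
  | ident v => rw [ghostOf_ident, pathOf_ident, vertex_mul_self, Λ.s_ident]
  | nonzero a =>
    rw [ghostOf_coe, pathOf_coe]
    exact mk_eq_mk R (.ghost_mul_path_self a)

theorem ghostOf_mul_pathOf_of_ne {a b : Λ.Path} (hd : Λ.d a = Λ.d b) (h : a ≠ b) :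
    ghostOf R a * pathOf R b = 0 := by
  induction a using ident_induction with
  | ident v =>
    rw [eq_ident_of_d_eq_zero (hd.symm.trans (Λ.d_ident v))] at h ⊢
    rw [ghostOf_ident, pathOf_ident, vertex_mul_of_ne R (ne_of_apply_ne Λ.ident h)]
  | nonzero a =>
    have hb : Λ.d b ≠ 0 := hd ▸ a.2
    rw [ghostOf_coe, pathOf_coe R ⟨b, hb⟩]
    exact mk_eq_mk R (.ghost_mul_path_ne a ⟨b, hb⟩ hd (ne_of_apply_ne Subtype.val h))

theorem vertex_eq_sum (v : Λ.Vertex) {n : Fin k → ℕ} (hn : n ≠ 0) :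
    vertex R v = ∑ c ∈ pathsOfDegree v n, path R c * ghost R c :=
  (mk_eq_mk R (.vertex_eq_sum v n hn)).trans (map_sum (mkHom Λ R) _ _)

variable (Λ) in
/-- The universal Kumjian–Pask family, that of the generators of the Kumjian–Pask algebra. -/
@[simps]
noncomputable def universal : Λ.KPFamily (Λ.KP R) where
  path := pathOf R
  ghost := ghostOf R
  ghost_ident v := by rw [ghostOf_ident, pathOf_ident]
  path_mul_path := pathOf_mul_pathOf R
  ghost_mul_ghost := ghostOf_mul_ghostOf R
  ghost_mul_path_self a := by rw [ghostOf_mul_pathOf_self, pathOf_ident]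
  ghost_mul_path_of_ne := ghostOf_mul_pathOf_of_ne R
  path_ident_eq_sum v n hn := by
    simpa only [pathOf_ident, pathOf_coe, ghostOf_coe] using vertex_eq_sum R v hn

theorem universal_gen (g : Λ.Gen) : (universal Λ R).gen g = mk Λ R (FreeAlg.of R g) :=
  match g with
  | .vertex v => pathOf_ident R v
  | .path a => pathOf_coe R a
  | .ghost a => ghostOf_coe R a

variable (Λ) in
/-- The quotient map from the free algebra as a homomorphism of nonunital algebras. -/
noncomputable def mkAlgHom : Λ.FreeAlg R →ₙₐ[R] Λ.KP R :=
  { mkHom Λ R with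
    map_smul' := fun _ _ => rfl
    map_mul' := fun _ _ => rfl }

theorem freeLift_universal : (universal Λ R).freeLift R = mkAlgHom Λ R := by
  refine MonoidAlgebra.nonUnitalAlgHom_ext' R (FreeSemigroup.hom_ext (funext fun g => ?_))
  exact (KPFamily.freeLift_of R _ g).trans (universal_gen R g)

theorem monomialSpan_universal : (universal Λ R).monomialSpan R = ⊤ := by
  refine Submodule.eq_top_iff'.mpr fun x => ?_
  obtain ⟨x, rfl⟩ := mk_surjective Λ R x
  have hx := (universal Λ R).freeLift_mem_monomialSpan R x
  rwa [freeLift_universal] at hx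

end KP

namespace KPFamily

variable [Λ.RowFinite] (R : Type*) [CommRing R] {S : Type*} [NonUnitalRing S] [Module R S]
  [IsScalarTower R S S] [SMulCommClass R S S] (F : Λ.KPFamily S)

@[simp]
theorem lift_pathOf (a : Λ.Path) : F.lift R (KP.pathOf R a) = F.path a := by
  induction a using ident_induction with
  | ident v =>
    rw [KP.pathOf_ident]
    exact F.lift_mk_of R (.vertex v)
  | nonzero a =>
    rw [KP.pathOf_coe]
    exact F.lift_mk_of R (.path a)

@[simp]
theorem lift_ghostOf (a : Λ.Path) : F.lift R (KP.ghostOf R a) = F.ghost a := by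
  induction a using ident_induction with
  | ident v =>
    rw [KP.ghostOf_ident, F.ghost_ident]
    exact F.lift_mk_of R (.vertex v)
  | nonzero a =>
    rw [KP.ghostOf_coe]
    exact F.lift_mk_of R (.ghost a)

end KPFamily

end KGraph

theorem append_stream_const_replicate {α : Type*} (p : List α) (x : α) (n : ℕ) :
    (p ++ List.replicate n x) ++ₛ Stream'.const x = p ++ₛ Stream'.const x := by
  induction n with
  | zero => rw [List.replicate_zero, List.append_nil]
  | succ n ih =>
    rw [List.replicate_succ', ← List.append_assoc, Stream'.append_append_stream,
      Stream'.cons_append_stream, Stream'.nil_append_stream, ← Stream'.const_eq, ih]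

theorem take_length_append_eq_iff {α : Type*} (x : Stream' α) (p q : List α) :
    x.take (p ++ q).length = p ++ q ↔
      x.take p.length = p ∧ (x.drop p.length).take q.length = q := by
  rw [List.length_append, Stream'.take_add]
  exact List.append_eq_append_iff_of_size_eq_left (Stream'.length_take ..)

theorem getLast?_eq_of_append_const_eq {α : Type*} {p q : List α} {x : α}
    (h : p ++ₛ Stream'.const x = q ++ₛ Stream'.const x) (hlt : p.length < q.length) :
    q.getLast? = some x := by
  obtain ⟨m, hm⟩ := Nat.exists_eq_add_of_le (Nat.le_sub_one_of_lt hlt)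
  have hlast : q.length - 1 < q.length := by omega
  rw [List.getLast?_eq_getElem?, List.getElem?_eq_getElem hlast,
    ← Stream'.get_append_left _ q (Stream'.const x) hlast, ← h, hm, Stream'.get_append_right,
    Stream'.get_const]

theorem exists_sub_eq_sub_of_sum_eq {ι : Type*} [Fintype ι] [Nonempty ι] {u v : ι → ℤ}
    (h : ∑ i, u i = ∑ i, v i) :
    ∃ m n : ι → ℕ, m ≠ 0 ∧ n ≠ 0 ∧ ∑ i, m i = ∑ i, n i ∧
      (fun i => u i - m i) = fun i => v i - n i := by
  have hsub (i : ι) : u i - ((u i - v i).toNat + 1 : ℕ) = v i - ((v i - u i).toNat + 1 : ℕ) := by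
    omega
  refine ⟨fun i => (u i - v i).toNat + 1, fun i => (v i - u i).toNat + 1, ?_, ?_, ?_,
    funext hsub⟩
  · exact fun h0 => Nat.succ_ne_zero _ (congrFun h0 (Classical.arbitrary ι))
  · exact fun h0 => Nat.succ_ne_zero _ (congrFun h0 (Classical.arbitrary ι))
  · have hsum := Finset.sum_congr rfl fun i (_ : i ∈ Finset.univ) => hsub i
    rw [Finset.sum_sub_distrib, Finset.sum_sub_distrib, h] at hsum
    exact_mod_cast sub_right_injective hsum

namespace StdPath

variable {k l : ℕ}

theorem sum_src (a : StdPath k l) : ∑ i, a.src i = ∑ i, a.rng i - a.lv.length := by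
  rw [a.length_lv, Finset.sum_sub_distrib, sub_sub_cancel]

theorem length_lv_of_mem_pathsOfDegree {v : Fin k → ℤ} {n : Fin k → ℕ} {c : StdNonzeroPath k l}
    (hc : c ∈ KGraph.pathsOfDegree v n) : c.1.lv.length = ∑ i, n i := by
  obtain ⟨-, rfl⟩ := KGraph.mem_pathsOfDegree.mp hc
  exact length_eq c.1

theorem exists_mem_pathsOfDegree_lv_eq (v : Fin k → ℤ) {n : Fin k → ℕ} (hn : n ≠ 0)
    {p : List (Fin l)} (hp : p.length = ∑ i, n i) :
    ∃ c ∈ KGraph.pathsOfDegree (Λ := stdKGraph k l) v n, c.1.lv = p :=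
  ⟨⟨ofDeg v n p hp, (deg_ofDeg v n p hp).trans_ne hn⟩,
    KGraph.mem_pathsOfDegree.mpr ⟨rfl, deg_ofDeg v n p hp⟩, rfl⟩

theorem eq_of_mem_pathsOfDegree {v : Fin k → ℤ} {n : Fin k → ℕ} {c c' : StdNonzeroPath k l}
    (hc : c ∈ KGraph.pathsOfDegree v n) (hc' : c' ∈ KGraph.pathsOfDegree v n)
    (h : c.1.lv = c'.1.lv) : c = c' := by
  obtain ⟨hr, hd⟩ := KGraph.mem_pathsOfDegree.mp hc
  obtain ⟨hr', hd'⟩ := KGraph.mem_pathsOfDegree.mp hc'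
  exact Subtype.ext (ext_deg (hr.trans hr'.symm) (hd.trans hd'.symm) h)

theorem lv_eq_nil_iff {a : StdPath k l} : a.lv = [] ↔ a.deg = 0 := by
  rw [← List.length_eq_zero_iff, length_eq, Finset.sum_eq_zero_iff, funext_iff]
  simp only [Finset.mem_univ, true_imp_iff, Pi.zero_apply]

/-- The range and the word of a path: what a path retains in a product `a b*`. -/
def trace (a : StdPath k l) : (Fin k → ℤ) × List (Fin l) := (a.rng, a.lv)

theorem sum_src_eq_of_trace_eq {a b : StdPath k l} (h : a.trace = b.trace) :
    ∑ i, a.src i = ∑ i, b.src i := by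
  obtain ⟨hr, hl⟩ := Prod.ext_iff.mp h
  rw [sum_src, sum_src, show a.rng = b.rng from hr, show a.lv = b.lv from hl]

section Representation

/-- A model of the infinite paths of the standard `k`-graph: a range and an infinite word. -/
abbrev InfPath (k l : ℕ) : Type := (Fin k → ℤ) × Stream' (Fin l)

variable (R : Type*) [CommSemiring R]

/-- The action of a path `a` on functions of infinite paths, supported on the infinite paths that
start with `a`. -/
def pathOp (a : StdPath k l) : Module.End R (InfPath k l → R) :=
  LinearMap.pi fun y =>
    if y.1 = a.rng ∧ y.2.take a.lv.length = a.lv then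
      LinearMap.proj (a.src, y.2.drop a.lv.length)
    else 0

/-- The action of a ghost path `a*` on functions of infinite paths, by prepending `a`. -/
def ghostOp (a : StdPath k l) : Module.End R (InfPath k l → R) :=
  LinearMap.pi fun y => if y.1 = a.src then LinearMap.proj (a.rng, a.lv ++ₛ y.2) else 0

variable {R}

theorem pathOp_apply (a : StdPath k l) (φ : InfPath k l → R) (y : InfPath k l) :
    pathOp R a φ y =
      if y.1 = a.rng ∧ y.2.take a.lv.length = a.lv then φ (a.src, y.2.drop a.lv.length)
      else 0 := by
  rw [pathOp, LinearMap.pi_apply]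
  split_ifs <;> rfl

theorem ghostOp_apply (a : StdPath k l) (φ : InfPath k l → R) (y : InfPath k l) :
    ghostOp R a φ y = if y.1 = a.src then φ (a.rng, a.lv ++ₛ y.2) else 0 := by
  rw [ghostOp, LinearMap.pi_apply]
  split_ifs <;> rfl

theorem pathOp_mul_ghostOp_apply {a b : StdPath k l} (h : a.src = b.src) (φ : InfPath k l → R)
    (y : InfPath k l) :
    (pathOp R a * ghostOp R b) φ y =
      if y.1 = a.rng ∧ y.2.take a.lv.length = a.lv
      then φ (b.rng, b.lv ++ₛ y.2.drop a.lv.length) else 0 := by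
  simp only [Module.End.mul_apply, ghostOp_apply, pathOp_apply, h, if_true]

theorem pathOp_ident_apply (v : Fin k → ℤ) (φ : InfPath k l → R) (y : InfPath k l) :
    pathOp R ((stdKGraph k l).ident v) φ y = if y.1 = v then φ y else 0 := by
  obtain ⟨u, x⟩ := y
  rw [pathOp_apply]
  by_cases h : u = v <;> simp [h]

theorem ghostOp_ident (v : Fin k → ℤ) :
    ghostOp R ((stdKGraph k l).ident v) = pathOp R ((stdKGraph k l).ident v) := by
  ext φ ⟨u, x⟩
  rw [pathOp_ident_apply, ghostOp_apply]
  by_cases h : u = v <;> simp [h]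

theorem pathOp_mul_pathOp {a b : StdPath k l} (h : a.src = b.rng) :
    pathOp R a * pathOp R b = pathOp R (a.comp b h) := by
  ext φ y
  simp only [Module.End.mul_apply, pathOp_apply, comp, take_length_append_eq_iff]
  by_cases h1 : y.1 = a.rng ∧ y.2.take a.lv.length = a.lv
  · simp [h1, h]
  · rw [if_neg h1, if_neg fun h2 => h1 ⟨h2.1, h2.2.1⟩]

theorem ghostOp_mul_ghostOp {a b : StdPath k l} (h : a.src = b.rng) :
    ghostOp R b * ghostOp R a = ghostOp R (a.comp b h) := by
  ext φ y
  simp only [Module.End.mul_apply, ghostOp_apply, comp, h, if_true, Stream'.append_append_stream]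

theorem ghostOp_mul_pathOp_self (a : StdPath k l) :
    ghostOp R a * pathOp R a = pathOp R ((stdKGraph k l).ident a.src) := by
  ext φ ⟨u, x⟩
  rw [pathOp_ident_apply, Module.End.mul_apply, ghostOp_apply, pathOp_apply]
  by_cases h : u = a.src <;>
    simp [h, Stream'.take_append_of_le_length, Stream'.drop_append_stream]

theorem ghostOp_mul_pathOp_of_ne {a b : StdPath k l} (hd : a.deg = b.deg) (h : a ≠ b) :
    ghostOp R a * pathOp R b = 0 := by
  ext φ y
  have hlen : a.lv.length = b.lv.length := by rw [length_eq, length_eq, hd]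
  have hne : ¬ (a.rng = b.rng ∧ (a.lv ++ₛ y.2).take b.lv.length = b.lv) := by
    rw [← hlen, Stream'.take_append_of_le_length _ _ _ le_rfl, List.take_length]
    exact fun hab => h (ext_deg hab.1 hd hab.2)
  simp only [Module.End.mul_apply, ghostOp_apply, pathOp_apply, if_neg hne, ite_self,
    LinearMap.zero_apply, Pi.zero_apply]

-- An infinite path of range `v` starts with exactly one path of range `v` and degree `n`.
theorem pathOp_ident_eq_sum (v : Fin k → ℤ) {n : Fin k → ℕ} (hn : n ≠ 0) :
    pathOp R ((stdKGraph k l).ident v) =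
      ∑ a ∈ KGraph.pathsOfDegree (Λ := stdKGraph k l) v n, pathOp R a.1 * ghostOp R a.1 := by
  ext φ y
  rw [pathOp_ident_apply]
  simp only [LinearMap.sum_apply, Finset.sum_apply, pathOp_mul_ghostOp_apply rfl]
  split_ifs with hv
  · obtain ⟨c, hc, hlv⟩ :=
      exists_mem_pathsOfDegree_lv_eq v hn (Stream'.length_take (∑ i, n i) y.2)
    rw [Finset.sum_eq_single_of_mem c hc]
    · have hr : c.1.rng = v := (KGraph.mem_pathsOfDegree.mp hc).1
      simp [hlv, hr, ← hv]
    · intro a ha hne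
      refine if_neg fun h => hne (eq_of_mem_pathsOfDegree ha hc ?_)
      rw [hlv, ← length_lv_of_mem_pathsOfDegree ha, h.2]
  · refine (Finset.sum_eq_zero fun a ha => if_neg fun h => hv ?_).symm
    exact h.1.trans (KGraph.mem_pathsOfDegree.mp ha).1

variable (R k l) in
/-- The representation of the Kumjian–Pask relations on functions of infinite paths. -/
@[simps]
def infPathFamily : (stdKGraph k l).KPFamily (Module.End R (InfPath k l → R)) where
  path := pathOp R
  ghost := ghostOp R
  ghost_ident := ghostOp_ident
  path_mul_path := pathOp_mul_pathOp
  ghost_mul_ghost := ghostOp_mul_ghostOp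
  ghost_mul_path_self := ghostOp_mul_pathOp_self
  ghost_mul_path_of_ne := ghostOp_mul_pathOp_of_ne
  path_ident_eq_sum := pathOp_ident_eq_sum

end Representation

end StdPath

namespace StdPath

variable {k l : ℕ} [NeZero l]

theorem deg_allOnes (v : Fin k → ℤ) (n : Fin k → ℕ) : (allOnes v n : StdPath k l).deg = n :=
  deg_ofDeg ..

theorem src_extendOnes (a : StdPath k l) (n : Fin k → ℕ) :
    (a.extendOnes n).src = fun i => a.src i - n i := rfl

theorem lv_extendOnes (a : StdPath k l) (n : Fin k → ℕ) :
    (a.extendOnes n).lv = a.lv ++ List.replicate (∑ i, n i) 0 := rfl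

theorem extendOnes_extendOnes (a : StdPath k l) (m n : Fin k → ℕ) :
    (a.extendOnes m).extendOnes n = a.extendOnes (m + n) := by
  refine StdPath.ext rfl ?_ ?_
  · funext i
    simp only [src_extendOnes, Pi.add_apply, Nat.cast_add, sub_sub]
  · simp only [lv_extendOnes, List.append_assoc, List.replicate_append_replicate, Pi.add_apply,
      Finset.sum_add_distrib]

theorem getLast?_lv_extendOnes (a : StdPath k l) {n : Fin k → ℕ} (hn : n ≠ 0) :
    (a.extendOnes n).lv.getLast? = some 0 := by
  have hsum : ∑ i, n i ≠ 0 := by simpa [funext_iff] using hn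
  simp [lv_extendOnes, List.getLast?_replicate, hsum]

theorem exists_eq_extendOnes_single {a : StdPath k l} (h : a.lv.getLast? = some 0) {i : Fin k}
    (hi : a.src i < a.rng i) : ∃ a' : StdPath k l, a = a'.extendOnes (Pi.single i 1) := by
  obtain ⟨p, hp⟩ := List.getLast?_eq_some_iff.mp h
  refine ⟨⟨a.rng, a.src + Pi.single i 1, p, fun j => ?_, ?_⟩, StdPath.ext rfl ?_ ?_⟩
  · obtain rfl | hj := eq_or_ne j i
    · simpa using hi
    · simpa [hj] using a.le j
  · have hlen := a.length_lv
    rw [hp, List.length_append, List.length_singleton, Nat.cast_add_one] at hlen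
    simp only [Pi.add_apply, sub_add_eq_sub_sub, Finset.sum_sub_distrib (f := fun j => a.rng j - _),
      Finset.sum_pi_single', Finset.mem_univ, if_true, ← hlen, add_sub_cancel_right]
  · funext j
    obtain rfl | hj := eq_or_ne j i <;> simp [src_extendOnes, *]
  · simp [lv_extendOnes, hp]

/-- The infinite path obtained from `a` by appending infinitely many `1`s (`0 : Fin l`). -/
def infPath (a : StdPath k l) : InfPath k l := (a.rng, a.lv ++ₛ Stream'.const 0)

theorem infPath_extendOnes (a : StdPath k l) (n : Fin k → ℕ) :
    (a.extendOnes n).infPath = a.infPath :=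
  Prod.ext rfl (append_stream_const_replicate a.lv 0 _)

/-- The paths `a` and `b` have a common source but no common tail `λ^{v,n}` with `n ≠ 0`. For paths
of nonzero degree this is membership in `pairsA`; here degree zero is allowed as well. -/
structure IsReduced (a b : StdPath k l) : Prop where
  src_eq : a.src = b.src
  not_exists_tail : ¬ ∃ (n : Fin k → ℕ) (a' b' : StdPath k l),
    n ≠ 0 ∧ a = a'.extendOnes n ∧ b = b'.extendOnes n

theorem mem_pairsA_iff {x : StdNonzeroPath k l × StdNonzeroPath k l} :
    x ∈ pairsA k l ↔ IsReduced x.1.1 x.2.1 :=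
  ⟨fun h => ⟨h.1, h.2⟩, fun h => ⟨h.src_eq, h.not_exists_tail⟩⟩

theorem isReduced_of_getLast?_left_ne {a b : StdPath k l} (hs : a.src = b.src)
    (h : a.lv.getLast? ≠ some 0) : IsReduced a b := by
  refine ⟨hs, ?_⟩
  rintro ⟨n, a', b', hn, rfl, rfl⟩
  exact h (getLast?_lv_extendOnes a' hn)

theorem isReduced_of_getLast?_right_ne {a b : StdPath k l} (hs : a.src = b.src)
    (h : b.lv.getLast? ≠ some 0) : IsReduced a b := by
  refine ⟨hs, ?_⟩
  rintro ⟨n, a', b', hn, rfl, rfl⟩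
  exact h (getLast?_lv_extendOnes b' hn)

theorem exists_extendOnes_single_of_not_isReduced {a b : StdPath k l} (hs : a.src = b.src)
    (h : ¬ IsReduced a b) : ∃ (i : Fin k) (a' b' : StdPath k l), a'.src = b'.src ∧
      a = a'.extendOnes (Pi.single i 1) ∧ b = b'.extendOnes (Pi.single i 1) := by
  obtain ⟨n, a', b', hn, rfl, rfl⟩ := not_not.mp fun hne => h ⟨hs, hne⟩
  obtain ⟨i, hi⟩ := Function.ne_iff.mp hn
  have hle : Pi.single i 1 ≤ n := fun j => by
    obtain rfl | hj := eq_or_ne j i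
    · simpa using Nat.one_le_iff_ne_zero.mpr hi
    · simp [hj]
  refine ⟨i, a'.extendOnes (n - Pi.single i 1), b'.extendOnes (n - Pi.single i 1), ?_, ?_, ?_⟩
  · funext j
    have hj := congrFun hs j
    simp only [src_extendOnes, sub_left_inj] at hj ⊢
    exact hj
  · rw [extendOnes_extendOnes, tsub_add_cancel_of_le hle]
  · rw [extendOnes_extendOnes, tsub_add_cancel_of_le hle]

-- If `a'` were longer than `a`, the equal ranges would force `a'.src` below `a.src` in some
-- coordinate `i`, and then both `a'` and `b'` could be shortened in direction `i`.
theorem IsReduced.length_le {a b a' b' : StdPath k l} (h' : IsReduced a' b') (hs : a.src = b.src)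
    (ha : a.infPath = a'.infPath) (hb : b.infPath = b'.infPath) :
    a'.lv.length ≤ a.lv.length := by
  by_contra! hlt
  obtain ⟨hra, hwa⟩ : a.rng = a'.rng ∧ _ := Prod.ext_iff.mp ha
  obtain ⟨hrb, hwb⟩ : b.rng = b'.rng ∧ _ := Prod.ext_iff.mp hb
  have hsum : ∑ i, a'.src i < ∑ i, a.src i := by
    rw [sum_src, sum_src, hra]
    omega
  have hltb : b.lv.length < b'.lv.length := by
    have hsumb := hsum
    rw [hs, h'.src_eq, sum_src, sum_src, hrb] at hsumb
    omega
  obtain ⟨i, -, hi⟩ := Finset.exists_lt_of_sum_lt hsum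
  have hia : a'.src i < a'.rng i := hra ▸ hi.trans_le (a.le i)
  have hib : b'.src i < b'.rng i := by
    rw [h'.src_eq, hs] at hi
    exact hrb ▸ hi.trans_le (b.le i)
  obtain ⟨c, hc⟩ := exists_eq_extendOnes_single (getLast?_eq_of_append_const_eq hwa hlt) hia
  obtain ⟨d, hd⟩ := exists_eq_extendOnes_single (getLast?_eq_of_append_const_eq hwb hltb) hib
  exact h'.not_exists_tail ⟨Pi.single i 1, c, d, by simp, hc, hd⟩

theorem IsReduced.trace_eq {a b a' b' : StdPath k l} (h : IsReduced a b) (h' : IsReduced a' b')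
    (ha : a.infPath = a'.infPath) (hb : b.infPath = b'.infPath) :
    a.trace = a'.trace ∧ b.trace = b'.trace := by
  have hlen : a.lv.length = a'.lv.length :=
    (h.length_le h'.src_eq ha.symm hb.symm).antisymm (h'.length_le h.src_eq ha hb)
  obtain ⟨hra, hwa⟩ : a.rng = a'.rng ∧ _ := Prod.ext_iff.mp ha
  obtain ⟨hrb, hwb⟩ : b.rng = b'.rng ∧ _ := Prod.ext_iff.mp hb
  have hlenb : b.lv.length = b'.lv.length := by
    have e : ∑ i, a.src i = ∑ i, a'.src i := by rw [sum_src, sum_src, hra, hlen]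
    rw [h.src_eq, h'.src_eq, sum_src, sum_src, hrb] at e
    omega
  exact ⟨Prod.ext hra (Stream'.append_left_injective _ _ _ _ hwa hlen),
    Prod.ext hrb (Stream'.append_left_injective _ _ _ _ hwb hlenb)⟩

theorem pairEquiv_iff_trace_eq [NeZero k] {x y : StdNonzeroPath k l × StdNonzeroPath k l}
    (hx : x ∈ pairsA k l) (hy : y ∈ pairsA k l) :
    PairEquiv x y ↔ x.1.1.trace = y.1.1.trace ∧ x.2.1.trace = y.2.1.trace := by
  rw [mem_pairsA_iff] at hx hy
  constructor
  · rintro ⟨m, n, -, -, h₁, h₂⟩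
    refine hx.trace_eq hy ?_ ?_
    · simpa only [infPath_extendOnes] using congrArg infPath h₁
    · simpa only [infPath_extendOnes] using congrArg infPath h₂
  · rintro ⟨h₁, h₂⟩
    obtain ⟨m, n, hm, hn, hsum, hsub⟩ :=
      exists_sub_eq_sub_of_sum_eq (sum_src_eq_of_trace_eq h₁)
    obtain ⟨hr₁, hl₁⟩ := Prod.ext_iff.mp h₁
    obtain ⟨hr₂, hl₂⟩ := Prod.ext_iff.mp h₂
    refine ⟨m, n, hm, hn, StdPath.ext hr₁ hsub ?_, StdPath.ext hr₂ ?_ ?_⟩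
    · rw [lv_extendOnes, lv_extendOnes, hsum]
      exact congrArg (· ++ _) hl₁
    · rw [src_extendOnes, src_extendOnes, ← hx.src_eq, ← hy.src_eq, hsub]
    · rw [lv_extendOnes, lv_extendOnes, hsum]
      exact congrArg (· ++ _) hl₂

end StdPath

namespace StdPath

open KGraph

variable {k l : ℕ}

theorem src_of_mem_pathsOfDegree {v : Fin k → ℤ} {n : Fin k → ℕ} {c : StdNonzeroPath k l}
    (hc : c ∈ pathsOfDegree v n) : c.1.src = fun i => v i - n i := by
  obtain ⟨rfl, rfl⟩ := mem_pathsOfDegree.mp hc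
  exact src_eq c.1

theorem sum_pathsOfDegree_congr {M : Type*} [AddCommMonoid M] {v w : Fin k → ℤ}
    {m n : Fin k → ℕ} (hm : m ≠ 0) (hn : n ≠ 0) (hsum : ∑ i, m i = ∑ i, n i)
    {f g : StdNonzeroPath k l → M}
    (h : ∀ c ∈ pathsOfDegree (Λ := stdKGraph k l) v m, ∀ d ∈ pathsOfDegree (Λ := stdKGraph k l) w n,
      c.1.lv = d.1.lv → f c = g d) :
    ∑ c ∈ pathsOfDegree v m, f c = ∑ d ∈ pathsOfDegree w n, g d := by
  choose e he hlv using fun c (hc : c ∈ pathsOfDegree (Λ := stdKGraph k l) v m) =>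
    exists_mem_pathsOfDegree_lv_eq w hn ((length_lv_of_mem_pathsOfDegree hc).trans hsum)
  refine Finset.sum_bij e he (fun c hc c' hc' hcc' => ?_) (fun d hd => ?_)
    fun c hc => h c hc _ (he c hc) (hlv c hc).symm
  · exact eq_of_mem_pathsOfDegree hc hc' (by rw [← hlv c hc, hcc', hlv c' hc'])
  · obtain ⟨c, hc, hcd⟩ := exists_mem_pathsOfDegree_lv_eq v hm
      ((length_lv_of_mem_pathsOfDegree hd).trans hsum.symm)
    exact ⟨c, hc, eq_of_mem_pathsOfDegree (he c hc) hd ((hlv c hc).trans hcd)⟩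

theorem comp_congr {a b a' b' : StdPath k l} (h : a.src = b.rng) (h' : a'.src = b'.rng)
    (ha : a.trace = a'.trace) (hsrc : b.src = b'.src) (hlv : b.lv = b'.lv) :
    a.comp b h = a'.comp b' h' :=
  StdPath.ext (congrArg Prod.fst ha) hsrc (congrArg₂ (· ++ ·) (congrArg Prod.snd ha) hlv)

theorem path_mul_ghost_congr [NeZero k] {S : Type*} [NonUnitalSemiring S]
    (F : (stdKGraph k l).KPFamily S) {a b a' b' : StdPath k l} (hs : a.src = b.src)
    (hs' : a'.src = b'.src) (ha : a.trace = a'.trace) (hb : b.trace = b'.trace) :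
    F.path a * F.ghost b = F.path a' * F.ghost b' := by
  obtain ⟨m, n, hm, hn, hsum, hsub⟩ := exists_sub_eq_sub_of_sum_eq (sum_src_eq_of_trace_eq ha)
  rw [F.path_mul_ghost_eq_sum hs hm, F.path_mul_ghost_eq_sum hs' hn]
  refine sum_pathsOfDegree_congr hm hn hsum fun c hc d hd hcd => ?_
  have hr := (mem_pathsOfDegree.mp hc).1
  have hr' := (mem_pathsOfDegree.mp hd).1
  have hsrc : c.1.src = d.1.src :=
    (src_of_mem_pathsOfDegree hc).trans (hsub.trans (src_of_mem_pathsOfDegree hd).symm)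
  rw [F.path_mul_path hr.symm, F.path_mul_path hr'.symm, F.ghost_mul_ghost (hs.symm.trans hr.symm),
    F.ghost_mul_ghost (hs'.symm.trans hr'.symm)]
  exact congrArg₂ (· * ·)
    (congrArg F.path (comp_congr hr.symm hr'.symm ha hsrc hcd))
    (congrArg F.ghost (comp_congr (hs.symm.trans hr.symm) (hs'.symm.trans hr'.symm) hb hsrc hcd))

variable [NeZero l] {S : Type*} [NonUnitalRing S] (F : (stdKGraph k l).KPFamily S)

theorem eq_allOnes_of_getLast?_eq {v : Fin k → ℤ} {i : Fin k} {c : StdNonzeroPath k l}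
    (hc : c ∈ pathsOfDegree v (Pi.single i 1)) {p : List (Fin l)}
    (h : (p ++ c.1.lv).getLast? = some 0) : c.1 = allOnes v (Pi.single i 1) := by
  obtain ⟨hr, hd⟩ := mem_pathsOfDegree.mp hc
  obtain ⟨x, hx⟩ := List.length_eq_one_iff.mp
    ((length_lv_of_mem_pathsOfDegree hc).trans (Fintype.sum_pi_single' i 1))
  obtain rfl : x = 0 := by simpa [hx] using h
  exact ext_deg hr (hd.trans (deg_allOnes ..).symm) (by simp [hx, allOnes, ofDeg])

-- The expansion of `a b*` in a unit degree has a single term ending in a common `1`; the other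
-- terms are reduced.
theorem path_mul_ghost_extendOnes_mem_iff {V : AddSubgroup S}
    (hV : ∀ a b, IsReduced a b → F.path a * F.ghost b ∈ V) {a b : StdPath k l}
    (hs : a.src = b.src) (i : Fin k) :
    F.path (a.extendOnes (Pi.single i 1)) * F.ghost (b.extendOnes (Pi.single i 1)) ∈ V ↔
      F.path a * F.ghost b ∈ V := by
  classical
  have hn : (Pi.single i 1 : Fin k → ℕ) ≠ 0 := by simp
  let t : StdNonzeroPath k l :=
    ⟨allOnes a.src (Pi.single i 1), (deg_allOnes ..).trans_ne hn⟩
  have ht : t ∈ pathsOfDegree a.src (Pi.single i 1) :=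
    mem_pathsOfDegree.mpr ⟨rfl, deg_allOnes ..⟩
  have hrest : ∀ c ∈ (pathsOfDegree a.src (Pi.single i 1)).erase t,
      F.path a * F.path c.1 * (F.ghost c.1 * F.ghost b) ∈ V := by
    intro c hc
    obtain ⟨hne, hc⟩ := Finset.mem_erase.mp hc
    have hr := (mem_pathsOfDegree.mp hc).1
    rw [F.path_mul_path hr.symm, F.ghost_mul_ghost (hs.symm.trans hr.symm)]
    exact hV _ _ (isReduced_of_getLast?_left_ne rfl fun h =>
      hne (Subtype.ext (eq_allOnes_of_getLast?_eq hc h)))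
  have hb : b.comp t.1 hs.symm = b.extendOnes (Pi.single i 1) := by
    simp only [t, extendOnes, hs]
  rw [F.path_mul_ghost_eq_sum hs hn,
    ← Finset.add_sum_erase _ _ ht, V.add_mem_cancel_right (sum_mem hrest), F.path_mul_path rfl,
    F.ghost_mul_ghost hs.symm]
  exact iff_of_eq (congrArg (fun b' => F.path _ * F.ghost b' ∈ V) hb.symm)

theorem path_mul_ghost_mem_of_isReduced {V : AddSubgroup S}
    (hV : ∀ a b, IsReduced a b → F.path a * F.ghost b ∈ V) {a b : StdPath k l}
    (hs : a.src = b.src) : F.path a * F.ghost b ∈ V := by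
  induction hN : a.lv.length generalizing a b with
  | zero =>
    exact hV a b (isReduced_of_getLast?_left_ne hs (by simp [List.length_eq_zero_iff.mp hN]))
  | succ N ih =>
    by_cases hred : IsReduced a b
    · exact hV a b hred
    obtain ⟨i, a, b, hs', rfl, rfl⟩ := exists_extendOnes_single_of_not_isReduced hs hred
    rw [path_mul_ghost_extendOnes_mem_iff F hV hs']
    exact ih hs' (by simpa [lv_extendOnes] using hN)

end StdPath

theorem linearIndependent_of_triangular {ι R M α : Type*} [Ring R] [AddCommGroup M] [Module R M]
    [Preorder α] [WellFoundedLT α] {b : ι → M} (f : ι → M →ₗ[R] R) (rank : ι → α)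
    (hdiag : ∀ i, f i (b i) = 1) (htri : ∀ i j, f i (b j) ≠ 0 → j = i ∨ rank j < rank i) :
    LinearIndependent R b := by
  refine linearIndependent_iff'.mpr fun s g hg i hi => ?_
  induction hr : rank i using WellFoundedLT.induction generalizing i with
  | _ r ih =>
    subst hr
    have hother (j : ι) (hj : j ∈ s) (hji : j ≠ i) : f i (g j • b j) = 0 := by
      by_cases h0 : f i (b j) = 0
      · rw [map_smul, h0, smul_zero]
      · rw [ih _ ((htri i j h0).resolve_left hji) j hj rfl, zero_smul, map_zero]
    have hsum := congrArg (f i) hg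
    rw [map_sum, map_zero, Finset.sum_eq_single_of_mem i hi hother] at hsum
    simpa [hdiag] using hsum

namespace StdPath

variable {k l : ℕ} [NeZero l]

section CommSemiring

variable (R : Type*) [CommSemiring R] [DecidableEq (InfPath k l)]

theorem pathOp_mul_ghostOp_single_infPath_self {a b : StdPath k l} (h : a.src = b.src) :
    (pathOp R a * ghostOp R b) (Pi.single b.infPath 1) a.infPath = 1 := by
  simp [pathOp_mul_ghostOp_apply h, infPath, Stream'.take_append_of_le_length,
    Stream'.drop_append_stream]

variable {R} in
theorem infPath_eq_of_pathOp_mul_ghostOp_ne_zero {a b a' b' : StdPath k l} (hs : a'.src = b'.src)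
    (h : (pathOp R a' * ghostOp R b') (Pi.single b.infPath 1) a.infPath ≠ 0)
    (hle : a.lv.length ≤ a'.lv.length) : a'.infPath = a.infPath ∧ b'.infPath = b.infPath := by
  rw [pathOp_mul_ghostOp_apply hs] at h
  obtain ⟨⟨hr, htake⟩, hval⟩ := ite_ne_right_iff.mp h
  have hdrop : a.infPath.2.drop a'.lv.length = Stream'.const 0 := by
    rw [← Nat.add_sub_of_le hle, ← Stream'.drop_drop, infPath, Stream'.drop_append_stream,
      Stream'.drop_const]
  rw [hdrop] at hval
  refine ⟨Prod.ext hr.symm ?_, of_not_not fun hne => hval (Pi.single_eq_of_ne hne _)⟩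
  rw [← Stream'.append_take_drop a'.lv.length a.infPath.2, htake, hdrop, infPath]

end CommSemiring

variable {R : Type*} [CommRing R] {ι : Type*} {p : ι → StdPath k l × StdPath k l}

theorem linearIndependent_pathOp_mul_ghostOp (hsrc : ∀ i, (p i).1.src = (p i).2.src)
    (hinj : Function.Injective fun i => ((p i).1.infPath, (p i).2.infPath)) :
    LinearIndependent R fun i => pathOp R (p i).1 * ghostOp R (p i).2 := by
  classical
  refine linearIndependent_of_triangular
    (fun i => LinearMap.proj (p i).1.infPath ∘ₗ LinearMap.applyₗ (Pi.single (p i).2.infPath 1))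
    (fun i => (p i).1.lv.length) (fun i => pathOp_mul_ghostOp_single_infPath_self R (hsrc i))
    fun i j hij => ?_
  refine or_iff_not_imp_right.mpr fun hle => hinj (Prod.ext_iff.mpr ?_)
  exact infPath_eq_of_pathOp_mul_ghostOp_ne_zero (hsrc j) hij (not_lt.mp hle)

theorem linearIndependent_pathOf_mul_ghostOf (hsrc : ∀ i, (p i).1.src = (p i).2.src)
    (hinj : Function.Injective fun i => ((p i).1.infPath, (p i).2.infPath)) :
    LinearIndependent R fun i => KGraph.KP.pathOf (Λ := stdKGraph k l) R (p i).1 *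
      KGraph.KP.ghostOf (Λ := stdKGraph k l) R (p i).2 := by
  refine LinearIndependent.of_comp
    ((infPathFamily k l R).lift R : _ →ₗ[R] Module.End R (InfPath k l → R)) ?_
  simpa [Function.comp_def] using linearIndependent_pathOp_mul_ghostOp (R := R) hsrc hinj

end StdPath

theorem IsRepresentativeSet.eq_of_trace_eq {k l : ℕ} [NeZero k] [NeZero l]
    {𝓡 : Set (StdNonzeroPath k l × StdNonzeroPath k l)} (h𝓡 : IsRepresentativeSet 𝓡)
    {x y : StdNonzeroPath k l × StdNonzeroPath k l} (hx : x ∈ 𝓡) (hy : y ∈ 𝓡)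
    (h₁ : x.1.1.trace = y.1.1.trace) (h₂ : x.2.1.trace = y.2.1.trace) : x = y := by
  have hxA := h𝓡.1 hx
  exact (h𝓡.2 x hxA).unique ⟨hx, (StdPath.pairEquiv_iff_trace_eq hxA hxA).mpr ⟨rfl, rfl⟩⟩
    ⟨hy, (StdPath.pairEquiv_iff_trace_eq hxA (h𝓡.1 hy)).mpr ⟨h₁, h₂⟩⟩

namespace StdPath

variable {k l : ℕ} {𝓡 : Set (StdNonzeroPath k l × StdNonzeroPath k l)}

/-- The pairs `(a, b)` for which the basis consists of the products `a b*`, where a vertex is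
written as a product of the path of degree zero at it with itself. -/
def basisPair (𝓡 : Set (StdNonzeroPath k l × StdNonzeroPath k l)) :
    (stdKGraph k l).Vertex ⊕ StdNonzeroPath k l ⊕ StdNonzeroPath k l ⊕ 𝓡 →
      StdPath k l × StdPath k l
  | .inl v => ((stdKGraph k l).ident v, (stdKGraph k l).ident v)
  | .inr (.inl a) => (a.1, (stdKGraph k l).ident a.1.src)
  | .inr (.inr (.inl a)) => ((stdKGraph k l).ident a.1.src, a.1)
  | .inr (.inr (.inr x)) => (x.1.1.1, x.1.2.1)

@[simp]
theorem lv_ne_nil (a : StdNonzeroPath k l) : a.1.lv ≠ [] := lv_eq_nil_iff.not.mpr a.2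

variable [NeZero l]

theorem basisPair_isReduced (h𝓡 : 𝓡 ⊆ pairsA k l) :
    ∀ i, IsReduced (basisPair 𝓡 i).1 (basisPair 𝓡 i).2
  | .inl _ => isReduced_of_getLast?_left_ne rfl nofun
  | .inr (.inl _) => isReduced_of_getLast?_right_ne rfl nofun
  | .inr (.inr (.inl _)) => isReduced_of_getLast?_left_ne rfl nofun
  | .inr (.inr (.inr x)) => mem_pairsA_iff.mp (h𝓡 x.2)

theorem basisPair_trace_injective [NeZero k] (h𝓡 : IsRepresentativeSet 𝓡) :
    Function.Injective fun i => ((basisPair 𝓡 i).1.trace, (basisPair 𝓡 i).2.trace) := by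
  rintro (v | a | a | x) (w | b | b | y) h <;>
    simp only [basisPair, trace, Prod.mk.injEq, lv_ne_nil, (lv_ne_nil _).symm, and_false,
      false_and] at h
  · exact congrArg Sum.inl h.1.1
  · exact congrArg (Sum.inr ∘ Sum.inl) (Subtype.ext (StdPath.ext h.1.1 h.2.1 h.1.2))
  · exact congrArg (Sum.inr ∘ Sum.inr ∘ Sum.inl) (Subtype.ext (StdPath.ext h.2.1 h.1.1 h.2.2))
  · exact congrArg (Sum.inr ∘ Sum.inr ∘ Sum.inr) (Subtype.ext (h𝓡.eq_of_trace_eq x.2 y.2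
      (Prod.ext h.1.1 h.1.2) (Prod.ext h.2.1 h.2.2)))

theorem exists_basisPair_trace_eq [NeZero k] (h𝓡 : IsRepresentativeSet 𝓡) {a b : StdPath k l}
    (h : IsReduced a b) :
    ∃ i, (basisPair 𝓡 i).1.trace = a.trace ∧ (basisPair 𝓡 i).2.trace = b.trace := by
  have hs := h.src_eq
  induction a using KGraph.ident_induction (Λ := stdKGraph k l) with
  | ident v =>
    induction b using KGraph.ident_induction (Λ := stdKGraph k l) with
    | ident w => exact ⟨.inl v, rfl, congrArg (·, []) hs⟩
    | nonzero b => exact ⟨.inr (.inr (.inl b)), congrArg (·, []) hs.symm, rfl⟩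
  | nonzero a =>
    induction b using KGraph.ident_induction (Λ := stdKGraph k l) with
    | ident w => exact ⟨.inr (.inl a), rfl, congrArg (·, []) hs⟩
    | nonzero b =>
      have hA : (a, b) ∈ pairsA k l := mem_pairsA_iff.mpr h
      obtain ⟨y, ⟨hy, hxy⟩, -⟩ := h𝓡.2 _ hA
      obtain ⟨h₁, h₂⟩ := (pairEquiv_iff_trace_eq hA (h𝓡.1 hy)).mp hxy
      exact ⟨.inr (.inr (.inr ⟨y, hy⟩)), h₁.symm, h₂.symm⟩

theorem basisPair_infPath_injective [NeZero k] (h𝓡 : IsRepresentativeSet 𝓡) :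
    Function.Injective fun i => ((basisPair 𝓡 i).1.infPath, (basisPair 𝓡 i).2.infPath) := by
  intro i j h
  obtain ⟨h₁, h₂⟩ := Prod.ext_iff.mp h
  exact basisPair_trace_injective h𝓡 (Prod.ext_iff.mpr
    ((basisPair_isReduced h𝓡.1 i).trace_eq (basisPair_isReduced h𝓡.1 j) h₁ h₂))

theorem span_basisPair [NeZero k] (R : Type*) [CommRing R] (h𝓡 : IsRepresentativeSet 𝓡) :
    Submodule.span R (Set.range fun i => KGraph.KP.pathOf (Λ := stdKGraph k l) R (basisPair 𝓡 i).1 *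
      KGraph.KP.ghostOf (Λ := stdKGraph k l) R (basisPair 𝓡 i).2) = ⊤ := by
  refine top_unique ?_
  rw [← KGraph.KP.monomialSpan_universal R, KGraph.KPFamily.monomialSpan, Submodule.span_le]
  rintro _ ⟨a, b, hs, rfl⟩
  refine path_mul_ghost_mem_of_isReduced (KGraph.KP.universal (stdKGraph k l) R)
    (V := (Submodule.span R _).toAddSubgroup) (fun a b hab => ?_) hs
  obtain ⟨i, ha, hb⟩ := exists_basisPair_trace_eq h𝓡 hab
  rw [← path_mul_ghost_congr _ (basisPair_isReduced h𝓡.1 i).src_eq hab.src_eq ha hb]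
  exact Submodule.subset_span ⟨i, rfl⟩

end StdPath

theorem theorem14 (k l : ℕ) [NeZero k] [NeZero l] (R : Type*) [CommRing R]
    (𝓡 : Set (StdNonzeroPath k l × StdNonzeroPath k l)) (h𝓡 : IsRepresentativeSet 𝓡) :
    ∃ B : Module.Basis
        ((stdKGraph k l).Vertex ⊕ StdNonzeroPath k l ⊕ StdNonzeroPath k l ⊕ 𝓡) R
        ((stdKGraph k l).KP R),
      (∀ v, B (.inl v) = KGraph.KP.vertex R v) ∧
      (∀ a, B (.inr (.inl a)) = KGraph.KP.path R a) ∧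
      (∀ a, B (.inr (.inr (.inl a))) = KGraph.KP.ghost R a) ∧
      (∀ x : 𝓡, B (.inr (.inr (.inr x))) =
        KGraph.KP.path R x.1.1 * KGraph.KP.ghost R x.1.2) := by
  let B := Module.Basis.mk (StdPath.linearIndependent_pathOf_mul_ghostOf (R := R)
    (fun i => (StdPath.basisPair_isReduced h𝓡.1 i).src_eq)
    (StdPath.basisPair_infPath_injective h𝓡)) (StdPath.span_basisPair R h𝓡).ge
  have hB (i) : B i = KGraph.KP.pathOf (Λ := stdKGraph k l) R (StdPath.basisPair 𝓡 i).1 *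
      KGraph.KP.ghostOf (Λ := stdKGraph k l) R (StdPath.basisPair 𝓡 i).2 := Module.Basis.mk_apply ..
  refine ⟨B, fun v => ?_, fun a => ?_, fun a => ?_, fun x => ?_⟩ <;> rw [hB]
  · rw [StdPath.basisPair, KGraph.KP.pathOf_ident, KGraph.KP.ghostOf_ident,
      KGraph.KP.vertex_mul_self]
  · rw [StdPath.basisPair, KGraph.KP.ghostOf_ident]
    exact (KGraph.KP.pathOf_mul_vertex R a.1).trans (KGraph.KP.pathOf_coe R a)
  · rw [StdPath.basisPair, KGraph.KP.pathOf_ident]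
    exact (KGraph.KP.vertex_mul_ghostOf R a.1).trans (KGraph.KP.ghostOf_coe R a)
  · exact congrArg₂ (· * ·) (KGraph.KP.pathOf_coe R x.1.1) (KGraph.KP.ghostOf_coe R x.1.2)
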